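/- Let $n\ge 2$ and let $\underline\zeta=(\zeta_1,\dots,\zeta_n)\in\mathbb{R}^n$ be such that $1,\zeta_1,\dots,\zeta_n$ are linearly independent over $\mathbb{Q}$. For $1\le j\le n+1$ let $w_{n,j}$ (respectively $\widehat w_{n,j}$) be the supremum in $[0,\infty]$ of the real $\nu$ such that the system $$\max\{|x|,|y_1|,\dots,|y_n|\}\le X,\qquad |x+\zeta_1y_1+\cdots+\zeta_ny_n|\le X^{-\nu}$$ has $j$ linearly independent solutions $(x,y_1,\dots,y_n)\in\mathbb{Z}^{n+1}$ for arbitrarily large $X$ (respectively for all sufficiently large $X$). Let $\lambda_{n,j}$ and $\widehat\lambda_{n,j}$ be defined in the same way from the system $$|x|\le X,\qquad \max_{1\le j\le n}|\zeta_jx-y_j|\le X^{-\nu}.$$ Put $w_n=w_{n,1}$, $\widehat w_n=\widehat w_{n,1}$, $\lambda_n=\lambda_{n,1}$, $\widehat\lambda_n=\widehat\lambda_{n,1}$. Let the size of $(x,y_1,\dots,y_n)\in\mathbb{Z}^{n+1}$ be $\max\{|x|,|y_1|,\dots,|y_n|\}$ and its error be $|x+\zeta_1y_1+\cdots+\zeta_ny_n|$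 (linear form case), or let its size be $|x|$ and its error be $\max_j|\zeta_jx-y_j|$ (simultaneous case). In either case, a best approximation is a nonzero integer vector such that no nonzero integer vector of strictly smaller size has strictly smaller error. A sequence of best approximations is a sequence $P_1,P_2,\dots$ of best approximations with strictly decreasing errors and nondecreasing sizes such that for every best approximation $Q$ some $P_k$ has the same size as $Q$ and error at most that of $Q$. We say that condition (I) holds (in the case considered) if there is a sequence of best approximations such that $P_k,P_{k+1},\dots,P_{k+n}$ are linearly independent for infinitely many $k$. Powers and quotients are taken in $[0,\infty]$ with $a/\infty=0$ for all $a\in[0,\infty]$, $a/0=\infty$ for $a>0$, and $a^0=1$; for $i=1$ the right-hand sides of (2) and (5) are $w_n$ and $\lambda_n$. Then: (1) $w_{n,3}\ge \widehat w_n^{\,2}/w_n$. If condition (I) holds in the linear form case, then (2) $w_{n,i}\ge \widehat w_n^{\,i-1}/w_n^{\,i-2}$ for $1\le i\le n+1$, and (3) $w_n\ge \widehat w_n\left(\dfrac{\widehat w_n-1}{n-1}\right)^{1/(n-1)}$. Likewise (4) $\lambda_{n,3}\ge \widehat\lambda_n^{\,2}/\lambda_n$, and if condition (I) holds in the simultaneous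 case, then (5) $\lambda_{n,i}\ge \widehat\lambda_n^{\,i-1}/\lambda_n^{\,i-2}$ for $1\le i\le n+1$, and (6) $\lambda_n\ge \widehat\lambda_n\left(\dfrac{(n-1)\widehat\lambda_n}{1-\widehat\lambda_n}\right)^{1/(n-1)}$. -/

import Mathlib

open Filter
open scoped ENNReal

namespace DiophApprox

variable {n : ℕ}

/-- The size `max {|x|, |y₁|, …, |yₙ|}` of an integer vector `v = (x, y₁, …, yₙ)`
(the norm on `Fin (n + 1) → ℤ` is the maximum norm). -/
noncomputable def linSize (v : Fin (n + 1) → ℤ) : ℝ := ‖v‖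

/-- The absolute value `|x + ζ₁ y₁ + ⋯ + ζₙ yₙ|` of the linear form at `v = (x, y₁, …, yₙ)`. -/
noncomputable def linError (ζ : Fin n → ℝ) (v : Fin (n + 1) → ℤ) : ℝ :=
  |(v 0 : ℝ) + ∑ j : Fin n, ζ j * (v j.succ : ℝ)|

/-- The size `|x|` of `v = (x, y₁, …, yₙ)` in simultaneous approximation. -/
noncomputable def simSize (v : Fin (n + 1) → ℤ) : ℝ := |(v 0 : ℝ)|

/-- The error `max_j |ζ_j x - y_j|` of `v = (x, y₁, …, yₙ)` in simultaneous approximation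
(the norm on `Fin n → ℝ` is the maximum norm). -/
noncomputable def simError (ζ : Fin n → ℝ) (v : Fin (n + 1) → ℤ) : ℝ :=
  ‖fun j : Fin n => ζ j * (v 0 : ℝ) - (v j.succ : ℝ)‖

/-- The system `size v ≤ X`, `err v ≤ X ^ (-ν)` has `j` linearly independent integer solutions. -/
def HasSolutions (size err : (Fin (n + 1) → ℤ) → ℝ) (j : ℕ) (ν X : ℝ) : Prop :=
  ∃ v : Fin j → (Fin (n + 1) → ℤ), LinearIndependent ℤ v ∧
    ∀ i, size (v i) ≤ X ∧ err (v i) ≤ X ^ (-ν)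

/-- The supremum, in `[0, ∞]`, of the `ν` for which there are `j` linearly independent solutions
for arbitrarily large `X`. -/
noncomputable def exponent (size err : (Fin (n + 1) → ℤ) → ℝ) (j : ℕ) : ℝ≥0∞ :=
  ⨆ (ν : ℝ) (_ : ∃ᶠ X : ℝ in atTop, HasSolutions size err j ν X), ENNReal.ofReal ν

/-- The supremum, in `[0, ∞]`, of the `ν` for which there are `j` linearly independent solutions
for all large `X`. -/
noncomputable def uniformExponent (size err : (Fin (n + 1) → ℤ) → ℝ) (j : ℕ) : ℝ≥0∞ :=
  ⨆ (ν : ℝ) (_ : ∀ᶠ X : ℝ in atTop, HasSolutions size err j ν X), ENNReal.ofReal ν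

/-- `w_{n,j}(ζ)`; in particular `w ζ 1` is `w_n(ζ)`. -/
noncomputable def w (ζ : Fin n → ℝ) (j : ℕ) : ℝ≥0∞ := exponent linSize (linError ζ) j

/-- `ŵ_{n,j}(ζ)`; in particular `wHat ζ 1` is `ŵ_n(ζ)`. -/
noncomputable def wHat (ζ : Fin n → ℝ) (j : ℕ) : ℝ≥0∞ := uniformExponent linSize (linError ζ) j

/-- `λ_{n,j}(ζ)`; in particular `lam ζ 1` is `λ_n(ζ)`. -/
noncomputable def lam (ζ : Fin n → ℝ) (j : ℕ) : ℝ≥0∞ := exponent simSize (simError ζ) j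

/-- `λ̂_{n,j}(ζ)`; in particular `lamHat ζ 1` is `λ̂_n(ζ)`. -/
noncomputable def lamHat (ζ : Fin n → ℝ) (j : ℕ) : ℝ≥0∞ := uniformExponent simSize (simError ζ) j

/-- A best approximation: a nonzero integer vector such that no nonzero integer vector of strictly
smaller size has a strictly smaller error. -/
def IsBestApprox (size err : (Fin (n + 1) → ℤ) → ℝ) (v : Fin (n + 1) → ℤ) : Prop :=
  v ≠ 0 ∧ ¬ ∃ u : Fin (n + 1) → ℤ, u ≠ 0 ∧ size u < size v ∧ err u < err v

/-- A sequence of best approximations, with strictly decreasing errors and nondecreasing sizes.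
It misses no best approximation, except that among those of equal size only the one of smallest
error has to be listed (so both the enumeration of all of them up to sign, where this is possible,
and the enumeration with strictly increasing sizes are allowed). -/
structure IsBestApproxSeq (size err : (Fin (n + 1) → ℤ) → ℝ)
    (P : ℕ → (Fin (n + 1) → ℤ)) : Prop where
  best : ∀ k, IsBestApprox size err (P k)
  err_strictAnti : StrictAnti fun k => err (P k)
  size_monotone : Monotone fun k => size (P k)
  exhaustive : ∀ v, IsBestApprox size err v → ∃ k, size (P k) = size v ∧ err (P k) ≤ err v

/-- Infinitely often, `n + 1` successive best approximations are linearly independent. -/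
def IndepSuccessiveBestApprox (size err : (Fin (n + 1) → ℤ) → ℝ) : Prop :=
  ∃ P : ℕ → (Fin (n + 1) → ℤ), IsBestApproxSeq size err P ∧
    {k : ℕ | LinearIndependent ℤ fun i : Fin (n + 1) => P (k + i)}.Infinite

end DiophApprox

/-! Take successive minimal points `P k`, with sizes X_k and errors L_k. For ν below the uniform
exponent and μ above the ordinary one, minimality gives L_k ≤ X_{k+1}^(-ν), while L_k > X_k^(-μ);
hence X_{k+1} ≤ X_k^(μ/ν) for large k. If m + 2 successive points from `P k` on are independent,
they have sizes at most X_{k+m+1} ≤ X_{k+1}^s with s = (μ/ν)^m, and errors at most X_{k+1}^(-ν). So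
they solve the system with exponent ν/s, and letting ν, μ tend to the two exponents gives (2) and
(5) (`pow_div_pow_le_exponent`).

For (3) and (6), n + 1 independent points have a nonzero integer determinant. Bounding it by sizes
and errors, and inserting the growth estimates, leaves a power of X_{k+1} that must not tend to 0
(`le_exponent_of_linear_det`, `le_exponent_of_simultaneous_det`).

For (1) and (4), three successive points are independent infinitely often; otherwise all late points
lie in one rational plane. In the simultaneous case an integer vector orthogonal to the plane then
gives a rational relation between 1, ζ₁, …, ζₙ. For the linear form, L_k X_{k+1} would stay bounded
below, against the bound L_k ≪ X_{k+1}^(-2) of Dirichlet type. -/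

namespace DiophApprox

/-! ### Minimal points and their growth -/

section Sequences

variable {n : ℕ} {size err : (Fin (n + 1) → ℤ) → ℝ} {P : ℕ → (Fin (n + 1) → ℤ)}

/-- The properties common to the two pairs `(linSize, linError ζ)` and `(simSize, simError ζ)`. -/
structure IsApproxSystem (size err : (Fin (n + 1) → ℤ) → ℝ) : Prop where
  size_nonneg : ∀ v, 0 ≤ size v
  err_pos : ∀ v, v ≠ 0 → 0 < err v
  size_smul : ∀ (a : ℤ) v, size (a • v) = |(a : ℝ)| * size v
  err_smul : ∀ (a : ℤ) v, err (a • v) = |(a : ℝ)| * err v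
  finite : ∀ A B : ℝ, {v | size v ≤ A ∧ err v ≤ B}.Finite

/-- A sequence of successive minimal points: no nonzero vector smaller than `P (k + 1)` has a
smaller error than `P k`. -/
structure IsMinimalSeq (size err : (Fin (n + 1) → ℤ) → ℝ)
    (P : ℕ → (Fin (n + 1) → ℤ)) : Prop where
  ne_zero : ∀ k, P k ≠ 0
  err_strictAnti : StrictAnti fun k => err (P k)
  size_monotone : Monotone fun k => size (P k)
  minimal : ∀ k u, u ≠ 0 → size u < size (P (k + 1)) → err (P k) ≤ err u

theorem IsApproxSystem.exists_isBestApprox (hS : IsApproxSystem size err)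
    {u : Fin (n + 1) → ℤ} (hu : u ≠ 0) :
    ∃ v, IsBestApprox size err v ∧ size v ≤ size u ∧ err v ≤ err u := by
  obtain ⟨v, ⟨hv0, hvs, hve⟩, hv⟩ := Set.exists_min_image
    {v | v ≠ 0 ∧ size v ≤ size u ∧ err v ≤ err u} err
    ((hS.finite (size u) (err u)).subset fun v hv => hv.2) ⟨u, hu, le_rfl, le_rfl⟩
  refine ⟨v, ⟨hv0, ?_⟩, hvs, hve⟩
  rintro ⟨z, hz0, hzs, hze⟩
  exact absurd (hv z ⟨hz0, hzs.le.trans hvs, hze.le.trans hve⟩) (not_le.2 hze)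

/-- A vector smaller than `P (k + 1)` is dominated by a best approximation; exhaustiveness lists one
at least as good, and monotone sizes put its index at most k. -/
theorem IsBestApproxSeq.isMinimalSeq (hS : IsApproxSystem size err)
    (hP : IsBestApproxSeq size err P) : IsMinimalSeq size err P where
  ne_zero k := (hP.best k).1
  err_strictAnti := hP.err_strictAnti
  size_monotone := hP.size_monotone
  minimal k u hu hs := by
    obtain ⟨v, hv, hvs, hve⟩ := hS.exists_isBestApprox hu
    obtain ⟨m, hms, hme⟩ := hP.exhaustive v hv
    have hmk : m < k + 1 := by
      by_contra! h
      have := hP.size_monotone h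
      linarith
    have := hP.err_strictAnti.antitone (Nat.lt_succ_iff.1 hmk)
    linarith

/-- The unconditional bounds come with no sequence, so one is built: the next point has least size
among the vectors of strictly smaller error. -/
theorem IsApproxSystem.exists_isMinimalSeq (hS : IsApproxSystem size err)
    (h : ∀ ε : ℝ, 0 < ε → ∃ u : Fin (n + 1) → ℤ, u ≠ 0 ∧ err u < ε) :
    ∃ P, IsMinimalSeq size err P := by
  have step : ∀ v : {v : Fin (n + 1) → ℤ // v ≠ 0}, ∃ u : {v : Fin (n + 1) → ℤ // v ≠ 0},
      err u < err v ∧ ∀ z : Fin (n + 1) → ℤ, z ≠ 0 → err z < err v → size u ≤ size z := by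
    rintro ⟨v, hv⟩
    obtain ⟨u₀, hu₀, hlt⟩ := h _ (hS.err_pos v hv)
    obtain ⟨u, ⟨hu0, hus, hue⟩, hu⟩ := Set.exists_min_image
      {z | z ≠ 0 ∧ size z ≤ size u₀ ∧ err z < err v} size
      ((hS.finite (size u₀) (err v)).subset fun z hz => ⟨hz.2.1, hz.2.2.le⟩)
      ⟨u₀, hu₀, le_rfl, hlt⟩
    refine ⟨⟨u, hu0⟩, hue, fun z hz hze => ?_⟩
    rcases le_total (size z) (size u₀) with hzs | hzs
    · exact hu z ⟨hz, hzs, hze⟩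
    · exact hus.trans hzs
  choose next hlt hmin using step
  obtain ⟨u₀, hu₀, -⟩ := h 1 one_pos
  -- Starting at the first iterate makes every term a value of `next`, which monotonicity of the
  -- sizes needs; `u₀` itself need not be minimal.
  let Q : ℕ → {v : Fin (n + 1) → ℤ // v ≠ 0} := fun k => next^[k + 1] ⟨u₀, hu₀⟩
  have hQ : ∀ k, Q (k + 1) = next (Q k) := fun k => Function.iterate_succ_apply' ..
  have hQ0 : ∀ k, ∃ v, Q k = next v := fun k => ⟨_, Function.iterate_succ_apply' ..⟩
  refine ⟨fun k => Q k, fun k => (Q k).2, strictAnti_nat_of_succ_lt fun k => ?_,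
    monotone_nat_of_le_succ fun k => ?_, fun k u hu hs => ?_⟩
  · rw [hQ]
    exact hlt _
  · obtain ⟨v, hv⟩ := hQ0 k
    rw [hQ, hv]
    exact hmin _ _ (next (next v)).2 ((hlt _).trans (hlt _))
  · by_contra! hlt'
    rw [hQ] at hs
    exact absurd (hmin _ u hu hlt') (not_le.2 hs)

theorem hasSolutions_one_iff {ν X : ℝ} :
    HasSolutions size err 1 ν X ↔ ∃ u, u ≠ 0 ∧ size u ≤ X ∧ err u ≤ X ^ (-ν) := by
  constructor
  · rintro ⟨v, hv, h⟩
    exact ⟨v 0, hv.ne_zero 0, h 0⟩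
  · rintro ⟨u, hu, h⟩
    exact ⟨fun _ => u, LinearIndependent.of_subsingleton 0 hu, fun _ => h⟩

theorem le_exponent {j : ℕ} {ν : ℝ} (h : ∃ᶠ X : ℝ in atTop, HasSolutions size err j ν X) :
    ENNReal.ofReal ν ≤ exponent size err j :=
  le_iSup₂ (f := fun (ν : ℝ) (_ : ∃ᶠ X : ℝ in atTop, HasSolutions size err j ν X) =>
    ENNReal.ofReal ν) ν h

theorem uniformExponent_le_exponent (j : ℕ) :
    uniformExponent size err j ≤ exponent size err j :=
  iSup₂_le fun _ h => le_exponent h.frequently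

theorem eventually_of_lt_uniformExponent {ν : ℝ}
    (h : ENNReal.ofReal ν < uniformExponent size err 1) :
    ∀ᶠ X : ℝ in atTop, ∃ u, u ≠ 0 ∧ size u ≤ X ∧ err u ≤ X ^ (-ν) := by
  obtain ⟨ν', h⟩ := lt_iSup_iff.1 h
  obtain ⟨hν', h⟩ := lt_iSup_iff.1 h
  have hlt : ν ≤ ν' := (ENNReal.ofReal_lt_ofReal_iff'.1 h).1.le
  filter_upwards [hν', eventually_ge_atTop 1] with X hX hX1
  obtain ⟨u, hu, hs, he⟩ := hasSolutions_one_iff.1 hX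
  exact ⟨u, hu, hs, he.trans (Real.rpow_le_rpow_of_exponent_le hX1 (neg_le_neg hlt))⟩

theorem eventually_of_exponent_lt {μ : ℝ} (h : exponent size err 1 < ENNReal.ofReal μ) :
    ∀ᶠ X : ℝ in atTop, ∀ u, u ≠ 0 → size u ≤ X → X ^ (-μ) < err u := by
  have h' : ¬ ∃ᶠ X : ℝ in atTop, HasSolutions size err 1 μ X := fun hf =>
    absurd (le_exponent hf) (not_le.2 h)
  filter_upwards [not_frequently.1 h'] with X hX u hu hs
  by_contra! he
  exact hX (hasSolutions_one_iff.2 ⟨u, hu, hs, he⟩)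

theorem IsApproxSystem.eventually_size_add_le (hS : IsApproxSystem size err) {r : ℝ} (hr : 0 ≤ r) (h : ∀ᶠ k in atTop, size (P (k + 1)) ≤ size (P k) ^ r) (m : ℕ) :
    ∀ᶠ k in atTop, size (P (k + m)) ≤ size (P k) ^ (r ^ m) := by
  induction m with
  | zero => simp
  | succ m ih =>
    filter_upwards [ih, (tendsto_add_atTop_nat m).eventually h] with k h1 h2
    refine h2.trans ?_
    rw [pow_succ, Real.rpow_mul (hS.size_nonneg _)]
    exact Real.rpow_le_rpow (hS.size_nonneg _) h1 hr

namespace IsMinimalSeq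

theorem tendsto_size (hS : IsApproxSystem size err) (hP : IsMinimalSeq size err P) :
    Tendsto (fun k => size (P k)) atTop atTop := by
  refine tendsto_atTop_atTop_of_monotone hP.size_monotone fun A => ?_
  by_contra! hA
  have hinj : Function.Injective P := fun a b hab =>
    hP.err_strictAnti.injective (congrArg err hab)
  refine Set.infinite_range_of_injective hinj ((hS.finite A (err (P 0))).subset ?_)
  rintro _ ⟨k, rfl⟩
  exact ⟨(hA k).le, hP.err_strictAnti.antitone (Nat.zero_le k)⟩

theorem tendsto_size_add (hS : IsApproxSystem size err) (hP : IsMinimalSeq size err P) (m : ℕ) :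
    Tendsto (fun k => size (P (k + m))) atTop atTop :=
  (hP.tendsto_size hS).comp (tendsto_add_atTop_nat m)

/-- Minimality only concerns sizes strictly below X_{k+1}, so the uniform bound is used at X <
X_{k+1} and X then tends to X_{k+1} from below. -/
theorem eventually_err_le (hS : IsApproxSystem size err) (hP : IsMinimalSeq size err P) {ν : ℝ}
    (h : ENNReal.ofReal ν < uniformExponent size err 1) :
    ∀ᶠ k in atTop, err (P k) ≤ size (P (k + 1)) ^ (-ν) := by
  obtain ⟨A, hA⟩ := eventually_atTop.1 (eventually_of_lt_uniformExponent h)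
  filter_upwards [(hP.tendsto_size_add hS 1).eventually_gt_atTop (max A 0)] with k hk
  obtain ⟨hkA, hk0⟩ := max_lt_iff.1 hk
  have hcont : Tendsto (fun X : ℝ => X ^ (-ν)) (nhdsWithin (size (P (k + 1)))
      (Set.Iio (size (P (k + 1))))) (nhds (size (P (k + 1)) ^ (-ν))) :=
    (Real.continuousAt_rpow_const _ _ (Or.inl hk0.ne')).tendsto.mono_left nhdsWithin_le_nhds
  refine ge_of_tendsto hcont ?_
  filter_upwards [Ioo_mem_nhdsLT hkA] with X hX
  obtain ⟨u, hu, hs, he⟩ := hA X hX.1.le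
  exact (hP.minimal k u hu (hs.trans_lt hX.2)).trans he

theorem eventually_lt_err (hS : IsApproxSystem size err) (hP : IsMinimalSeq size err P) {μ : ℝ}
    (h : exponent size err 1 < ENNReal.ofReal μ) :
    ∀ᶠ k in atTop, size (P k) ^ (-μ) < err (P k) :=
  ((hP.tendsto_size hS).eventually (eventually_of_exponent_lt h)).mono
    fun k hk => hk _ (hP.ne_zero k) le_rfl

theorem eventually_size_succ_le (hS : IsApproxSystem size err) (hP : IsMinimalSeq size err P)
    {ν μ : ℝ} (hν : 0 < ν) (h : ENNReal.ofReal ν < uniformExponent size err 1)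
    (h' : exponent size err 1 < ENNReal.ofReal μ) :
    ∀ᶠ k in atTop, size (P (k + 1)) ≤ size (P k) ^ (μ / ν) := by
  filter_upwards [hP.eventually_err_le hS h, hP.eventually_lt_err hS h',
    (hP.tendsto_size hS).eventually_gt_atTop 0,
    (hP.tendsto_size_add hS 1).eventually_gt_atTop 0] with k h1 h2 h3 h4
  have h5 := h2.trans_le h1
  rw [Real.rpow_neg h3.le, Real.rpow_neg h4.le,
    inv_lt_inv₀ (Real.rpow_pos_of_pos h3 _) (Real.rpow_pos_of_pos h4 _)] at h5
  rw [div_eq_mul_inv, Real.rpow_mul h3.le]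
  exact (Real.le_rpow_inv_iff_of_pos h4.le (Real.rpow_nonneg h3.le _) hν).2 h5.le

/-- The independent points themselves are the solutions, with X = X_{k+m+1}: their errors are at
most L_k ≤ X_{k+1}^(-ν) ≤ X^(-ν/s). -/
theorem le_exponent_of_frequently (hS : IsApproxSystem size err) (hP : IsMinimalSeq size err P)
    {m : ℕ} (hI : ∃ᶠ k in atTop, LinearIndependent ℤ fun i : Fin (m + 2) => P (k + i))
    {ν s : ℝ} (hν : 0 < ν) (h : ENNReal.ofReal ν < uniformExponent size err 1) (hs : 0 < s)
    (hg : ∀ᶠ k in atTop, size (P (k + m)) ≤ size (P k) ^ s) :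
    ENNReal.ofReal (ν / s) ≤ exponent size err (m + 2) := by
  refine le_exponent ((hP.tendsto_size_add hS (m + 1)).frequently ?_)
  refine (hI.and_eventually ((hP.eventually_err_le hS h).and
    (((tendsto_add_atTop_nat 1).eventually hg).and
      ((hP.tendsto_size_add hS (m + 1)).eventually_gt_atTop 0)))).mono ?_
  rintro k ⟨hk, h1, h2, h3⟩
  refine ⟨_, hk, fun i => ⟨hP.size_monotone (by omega), ?_⟩⟩
  have hX : 0 < size (P (k + 1)) := by
    by_contra! h0
    have h0' := le_antisymm h0 (hS.size_nonneg _)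
    rw [h0', Real.zero_rpow hs.ne'] at h2
    rw [show k + 1 + m = k + (m + 1) by ring] at h2
    linarith
  refine (hP.err_strictAnti.antitone (Nat.le_add_right k i)).trans (h1.trans ?_)
  rw [show k + 1 + m = k + (m + 1) by ring] at h2
  rw [Real.rpow_neg hX.le, Real.rpow_neg h3.le,
    inv_le_inv₀ (Real.rpow_pos_of_pos hX _) (Real.rpow_pos_of_pos h3 _)]
  calc size (P (k + (m + 1))) ^ (ν / s) ≤ (size (P (k + 1)) ^ s) ^ (ν / s) :=
        Real.rpow_le_rpow h3.le h2 (by positivity)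
    _ = size (P (k + 1)) ^ ν := by rw [← Real.rpow_mul hX.le, mul_div_cancel₀ _ hs.ne']

/-- Proportional vectors have sizes and errors in the same ratio, but here sizes do not decrease
while errors strictly decrease. -/
theorem pair_independent (hS : IsApproxSystem size err) (hP : IsMinimalSeq size err P) {k : ℕ}
    (hk : 0 < size (P k)) {a b : ℤ} (hab : a • P k + b • P (k + 1) = 0) : a = 0 ∧ b = 0 := by
  have h : a • P k = (-b) • P (k + 1) := by
    rw [neg_smul]; exact eq_neg_of_add_eq_zero_left hab
  have hs := congrArg size h
  have he := congrArg err h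
  rw [hS.size_smul, hS.size_smul, Int.cast_neg, abs_neg] at hs
  rw [hS.err_smul, hS.err_smul, Int.cast_neg, abs_neg] at he
  have h1 := hP.size_monotone (Nat.le_succ k)
  have h2 := hP.err_strictAnti (Nat.lt_succ_self k)
  have h3 := hS.err_pos _ (hP.ne_zero (k + 1))
  simp only [Nat.succ_eq_add_one] at h1 h2
  have hba : |(b : ℝ)| ≤ |(a : ℝ)| := by
    by_contra! hlt
    nlinarith [abs_nonneg (a : ℝ), abs_nonneg (b : ℝ)]
  have ha : |(a : ℝ)| = 0 := by
    by_contra hne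
    have : 0 < |(a : ℝ)| := lt_of_le_of_ne (abs_nonneg _) (Ne.symm hne)
    nlinarith
  have hb : |(b : ℝ)| = 0 := le_antisymm (ha ▸ hba) (abs_nonneg _)
  exact ⟨by simpa using ha, by simpa using hb⟩

/-- A linear relation between three successive minimal points involves both outer ones. -/
theorem exists_relation (hS : IsApproxSystem size err) (hP : IsMinimalSeq size err P) {k : ℕ}
    (hk : 0 < size (P k)) (hdep : ¬ LinearIndependent ℤ fun i : Fin 3 => P (k + i)) :
    ∃ a b c : ℤ, a ≠ 0 ∧ c ≠ 0 ∧ a • P k + b • P (k + 1) + c • P (k + 2) = 0 := by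
  obtain ⟨g, hg, i, hi⟩ := Fintype.not_linearIndependent_iff.1 hdep
  rw [Fin.sum_univ_three] at hg
  simp only [Fin.val_zero, Fin.val_one, Fin.val_two, add_zero] at hg
  refine ⟨g 0, g 1, g 2, fun h0 => ?_, fun h2 => ?_, hg⟩
  · rw [h0, zero_smul, zero_add] at hg
    have := hP.pair_independent hS (hk.trans_le (hP.size_monotone (Nat.le_succ k))) hg
    fin_cases i <;> simp_all
  · rw [h2, zero_smul, add_zero] at hg
    have := hP.pair_independent hS hk hg
    fin_cases i <;> simp_all

end IsMinimalSeq

end Sequences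

/-! ### Passing to the limit in the exponents -/

section Limits

variable {n : ℕ} {size err : (Fin (n + 1) → ℤ) → ℝ} {P : ℕ → (Fin (n + 1) → ℤ)}

theorem nonneg_of_frequently_one_le_mul_rpow {f : ℕ → ℝ} (hf : Tendsto f atTop atTop) {C e : ℝ}
    (h : ∃ᶠ k in atTop, 1 ≤ C * f k ^ e) : 0 ≤ e := by
  by_contra! he
  have h1 : Tendsto (fun k => C * f k ^ e) atTop (nhds (C * 0)) := by
    have := (tendsto_rpow_neg_atTop (neg_pos.2 he)).comp hf
    rw [neg_neg] at this
    exact this.const_mul C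
  rw [mul_zero] at h1
  exact h ((h1.eventually_lt_const one_pos).mono fun k hk => not_le.2 hk)

/-- Positive finite exponents, as real numbers, together with what lies below and above them. -/
theorem exists_real_exponents (h0 : 0 < uniformExponent size err 1)
    (hfin : exponent size err 1 ≠ ∞) :
    ∃ a b : ℝ, 0 < a ∧ 0 < b ∧ uniformExponent size err 1 = ENNReal.ofReal a ∧
      exponent size err 1 = ENNReal.ofReal b ∧
      ∀ᶠ ε : ℝ in nhdsWithin 0 (Set.Ioi 0), 0 < ε ∧ 0 < a - ε ∧ 0 < b + ε ∧
        ENNReal.ofReal (a - ε) < uniformExponent size err 1 ∧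
        exponent size err 1 < ENNReal.ofReal (b + ε) := by
  have hle := uniformExponent_le_exponent (size := size) (err := err) 1
  have hfin' := ne_top_of_le_ne_top hfin hle
  have ha := ENNReal.toReal_pos h0.ne' hfin'
  have hb := ENNReal.toReal_pos (h0.trans_le hle).ne' hfin
  refine ⟨_, _, ha, hb, (ENNReal.ofReal_toReal hfin').symm, (ENNReal.ofReal_toReal hfin).symm, ?_⟩
  filter_upwards [Ioo_mem_nhdsGT ha] with ε hε
  refine ⟨hε.1, sub_pos.2 hε.2, by linarith [hε.1], ?_, ?_⟩
  · conv_rhs => rw [← ENNReal.ofReal_toReal hfin']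
    exact (ENNReal.ofReal_lt_ofReal_iff ha).2 (by linarith [hε.1])
  · conv_lhs => rw [← ENNReal.ofReal_toReal hfin]
    exact (ENNReal.ofReal_lt_ofReal_iff (by linarith [hε.1])).2 (by linarith [hε.1])

namespace IsMinimalSeq

theorem uniformExponent_le_exponent_two (hS : IsApproxSystem size err)
    (hP : IsMinimalSeq size err P)
    (hI : ∃ᶠ k in atTop, LinearIndependent ℤ fun i : Fin 2 => P (k + i)) :
    uniformExponent size err 1 ≤ exponent size err 2 := by
  refine ENNReal.le_of_forall_nnreal_lt fun r hr => ?_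
  rcases eq_or_ne r 0 with rfl | hr0
  · simp
  · rw [← ENNReal.ofReal_coe_nnreal] at hr ⊢
    have := hP.le_exponent_of_frequently hS (m := 0) hI
      (NNReal.coe_pos.2 (pos_iff_ne_zero.2 hr0)) hr one_pos (by simp)
    simpa using this

theorem pow_div_pow_le_exponent (hS : IsApproxSystem size err) (hP : IsMinimalSeq size err P)
    {m : ℕ} (hI : ∃ᶠ k in atTop, LinearIndependent ℤ fun i : Fin (m + 2) => P (k + i)) :
    uniformExponent size err 1 ^ (m + 1) / exponent size err 1 ^ m ≤
      exponent size err (m + 2) := by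
  -- For m = 0 the denominator is 1 even if the exponent is ∞; for m > 0 an infinite exponent makes
  -- the left side 0.
  rcases Nat.eq_zero_or_pos m with rfl | hm
  · simpa using hP.uniformExponent_le_exponent_two hS hI
  rcases eq_or_ne (uniformExponent size err 1) 0 with h0 | h0
  · simp [h0]
  rcases eq_or_ne (exponent size err 1) ∞ with hfin | hfin
  · simp [hfin, ENNReal.top_pow hm.ne']
  obtain ⟨a, b, ha, hb, hae, hbe, hab⟩ := exists_real_exponents (pos_iff_ne_zero.2 h0) hfin
  rw [hae, hbe, ← ENNReal.ofReal_pow ha.le, ← ENNReal.ofReal_pow hb.le,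
    ← ENNReal.ofReal_div_of_pos (by positivity)]
  have hlim : ContinuousAt (fun ε : ℝ => ENNReal.ofReal ((a - ε) / ((b + ε) / (a - ε)) ^ m)) 0 := by
    refine ENNReal.continuous_ofReal.continuousAt.comp ?_
    refine ContinuousAt.div (by fun_prop) (ContinuousAt.pow (ContinuousAt.div (by fun_prop)
      (by fun_prop) (by simpa using ha.ne')) _) ?_
    have : 0 < b / a := by positivity
    simpa using (pow_pos this m).ne'
  have hval : a ^ (m + 1) / b ^ m = (a - 0) / ((b + 0) / (a - 0)) ^ m := by
    rw [sub_zero, add_zero, div_pow, pow_succ']; field_simp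
  rw [hval]
  refine le_of_tendsto (hlim.tendsto.mono_left (nhdsWithin_le_nhds (s := Set.Ioi 0))) ?_
  filter_upwards [hab] with ε ⟨_, h1, h2, h3, h4⟩
  exact hP.le_exponent_of_frequently hS hI h1 h3 (by positivity)
    (hS.eventually_size_add_le (by positivity) (hP.eventually_size_succ_le hS h1 h3 h4) m)

theorem zpow_div_zpow_le_exponent (hS : IsApproxSystem size err) (hP : IsMinimalSeq size err P)
    {i : ℕ} (hi : 1 ≤ i)
    (hI : ∃ᶠ k in atTop, LinearIndependent ℤ fun j : Fin i => P (k + j)) :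
    uniformExponent size err 1 ^ ((i : ℤ) - 1) / exponent size err 1 ^ ((i : ℤ) - 2) ≤
      exponent size err i := by
  rcases hi.eq_or_lt with rfl | hi
  -- At i = 1 the quotient is x^0 / y^(-1) = y.
  · simp [zpow_neg_one]
  · obtain ⟨m, rfl⟩ := Nat.exists_eq_add_of_le' hi
    have h1 : ((m + 2 : ℕ) : ℤ) - 1 = ((m + 1 : ℕ) : ℤ) := by push_cast; ring
    have h2 : ((m + 2 : ℕ) : ℤ) - 2 = ((m : ℕ) : ℤ) := by push_cast; ring
    rw [h1, h2, zpow_natCast, zpow_natCast]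
    exact hP.pow_div_pow_le_exponent hS hI

end IsMinimalSeq

theorem frequently_independent_of_le {i j : ℕ} (hij : i ≤ j)
    (h : ∃ᶠ k in atTop, LinearIndependent ℤ fun l : Fin j => P (k + l)) :
    ∃ᶠ k in atTop, LinearIndependent ℤ fun l : Fin i => P (k + l) :=
  h.mono fun _ hk => hk.comp (Fin.castLE hij) (Fin.castLE_injective hij)

end Limits

/-! ### General determinant estimates -/

section Determinants

theorem abs_det_le_of_abs_le_mul {ι : Type*} [Fintype ι] [DecidableEq ι] (A : Matrix ι ι ℝ)
    (r c : ι → ℝ) (h : ∀ i j, |A i j| ≤ r i * c j) :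
    |A.det| ≤ (Fintype.card ι).factorial * ((∏ i, r i) * ∏ i, c i) := by
  rw [Matrix.det_apply]
  calc |∑ σ : Equiv.Perm ι, Equiv.Perm.sign σ • ∏ i, A (σ i) i|
      ≤ ∑ σ : Equiv.Perm ι, |Equiv.Perm.sign σ • ∏ i, A (σ i) i| := Finset.abs_sum_le_sum_abs _ _
    _ ≤ ∑ _σ : Equiv.Perm ι, (∏ i, r i) * ∏ i, c i := by
        refine Finset.sum_le_sum fun σ _ => ?_
        have : |Equiv.Perm.sign σ • ∏ i, A (σ i) i| = ∏ i, |A (σ i) i| := by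
          rw [← Finset.abs_prod]
          rcases Int.units_eq_one_or (Equiv.Perm.sign σ) with h | h <;> simp [h]
        rw [this, ← Equiv.prod_comp σ r, ← Finset.prod_mul_distrib]
        exact Finset.prod_le_prod (fun i _ => abs_nonneg _) fun i _ => h _ _
    _ = _ := by
        rw [Finset.sum_const, Finset.card_univ, Fintype.card_perm, nsmul_eq_mul]

theorem one_le_abs_det_of_linearIndependent {ι : Type*} [Fintype ι] [DecidableEq ι]
    {v : ι → ι → ℤ} (hv : LinearIndependent ℤ v) :
    1 ≤ |(Matrix.of fun i j => (v i j : ℝ)).det| := by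
  have hdet : (Matrix.of v).det ≠ 0 := fun h0 => by
    obtain ⟨g, hg, hgv⟩ := Matrix.exists_vecMul_eq_zero_iff.2 h0
    refine hg (funext (Fintype.linearIndependent_iff.1 hv g ?_))
    rw [← hgv, Matrix.vecMul_eq_sum]
    rfl
  have hcast : (Matrix.of fun i j => (v i j : ℝ)).det = ((Matrix.of v).det : ℝ) := by
    have := (Int.castRingHom ℝ).map_det (Matrix.of v)
    simp only [eq_intCast] at this
    rw [this]
    rfl
  rw [hcast, ← Int.cast_abs]
  exact_mod_cast Int.one_le_abs hdet

end Determinants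

/-! ### From determinant inequalities to the ratio of the exponents -/

section Ratio

variable {m : ℕ} {size err : (Fin (m + 1 + 1) → ℤ) → ℝ} {P : ℕ → (Fin (m + 1 + 1) → ℤ)}

theorem ofReal_mul_rpow_le {a b : ℝ} (ha : 0 < a) (hb : 0 < b) (hm : 0 < m) {x : ℝ≥0∞}
    (hx : x ≤ ENNReal.ofReal ((b / a) ^ m)) :
    ENNReal.ofReal a * x ^ (1 / (((m + 1 : ℕ) : ℝ) - 1)) ≤ ENNReal.ofReal b := by
  have hm' : (0 : ℝ) < m := by exact_mod_cast hm
  have he : 1 / (((m + 1 : ℕ) : ℝ) - 1) = (m : ℝ)⁻¹ := by push_cast; simp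
  rw [he]
  calc ENNReal.ofReal a * x ^ (m : ℝ)⁻¹
      ≤ ENNReal.ofReal a * ENNReal.ofReal ((b / a) ^ m) ^ (m : ℝ)⁻¹ := by gcongr
    _ = ENNReal.ofReal b := by
        rw [ENNReal.ofReal_rpow_of_nonneg (by positivity) (by positivity),
          Real.pow_rpow_inv_natCast (by positivity) hm.ne', ← ENNReal.ofReal_mul ha.le,
          mul_div_cancel₀ _ ha.ne']

theorem natCast_succ_sub_one : ((m + 1 : ℕ) : ℝ≥0∞) - 1 = ENNReal.ofReal m := by
  rw [ENNReal.ofReal_natCast, Nat.cast_add, Nat.cast_one]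
  exact ENNReal.add_sub_cancel_right ENNReal.one_ne_top

/-- Here n = m + 1. The determinant is at most a constant times X_{k+1}^(-ν + 1 + s m), so ν - 1 ≤ m
s with s = (μ/ν)^m; the claim is the m-th root of the limiting inequality. -/
theorem le_exponent_of_linear_det (hS : IsApproxSystem size err) (hP : IsMinimalSeq size err P)
    (hm : 0 < m) {C : ℝ} (hC : 0 ≤ C)
    (hdet : ∃ᶠ k in atTop,
      1 ≤ C * (err (P k) * size (P (k + 1)) * size (P (k + 1 + m)) ^ m)) :
    uniformExponent size err 1 * ((uniformExponent size err 1 - 1) /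
      (((m + 1 : ℕ) : ℝ≥0∞) - 1)) ^ (1 / (((m + 1 : ℕ) : ℝ) - 1)) ≤ exponent size err 1 := by
  rcases eq_or_ne (uniformExponent size err 1) 0 with h0 | h0
  · simp [h0]
  rcases eq_or_ne (exponent size err 1) ∞ with hfin | hfin
  · simp [hfin]
  obtain ⟨a, b, ha, hb, hae, hbe, hab⟩ := exists_real_exponents (pos_iff_ne_zero.2 h0) hfin
  have hm' : (0 : ℝ) < m := by exact_mod_cast hm
  have key : ∀ᶠ ε : ℝ in nhdsWithin 0 (Set.Ioi 0),
      (a - ε) - 1 ≤ m * ((b + ε) / (a - ε)) ^ m := by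
    filter_upwards [hab] with ε ⟨_, h1, h2, h3, h4⟩
    set ν := a - ε
    set s := ((b + ε) / ν) ^ m
    have hg := hS.eventually_size_add_le (P := P) (by positivity)
      (hP.eventually_size_succ_le hS h1 h3 h4) m
    have hfr : ∃ᶠ k in atTop, 1 ≤ C * size (P (k + 1)) ^ (-ν + 1 + s * m) := by
      refine (hdet.and_eventually ((hP.eventually_err_le hS h3).and
        (((tendsto_add_atTop_nat 1).eventually hg).and
        ((hP.tendsto_size_add hS 1).eventually_gt_atTop 0)))).mono ?_
      rintro k ⟨hk, h5, h6, h7⟩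
      refine hk.trans (mul_le_mul_of_nonneg_left ?_ hC)
      rw [Real.rpow_add h7, Real.rpow_add h7, Real.rpow_one, Real.rpow_mul h7.le,
        Real.rpow_natCast]
      have := hS.size_nonneg (P (k + 1 + m))
      gcongr
    have := nonneg_of_frequently_one_le_mul_rpow (hP.tendsto_size_add hS 1) hfr
    linarith
  have hlim : a - 1 ≤ m * (b / a) ^ m := by
    have h1 : Tendsto (fun ε : ℝ => (a - ε) - 1) (nhdsWithin 0 (Set.Ioi 0)) (nhds (a - 0 - 1)) :=
      (Continuous.tendsto (by fun_prop) _).mono_left nhdsWithin_le_nhds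
    have h2 : ContinuousAt (fun ε : ℝ => m * ((b + ε) / (a - ε)) ^ m) 0 :=
      ContinuousAt.mul (by fun_prop) (ContinuousAt.pow (ContinuousAt.div (by fun_prop)
        (by fun_prop) (by simpa using ha.ne')) _)
    simpa using le_of_tendsto_of_tendsto h1 (h2.tendsto.mono_left nhdsWithin_le_nhds) key
  rw [hae, hbe]
  refine ofReal_mul_rpow_le ha hb hm ?_
  rw [natCast_succ_sub_one, ← ENNReal.ofReal_one, ← ENNReal.ofReal_sub _ zero_le_one,
    ← ENNReal.ofReal_div_of_pos hm']
  refine ENNReal.ofReal_le_ofReal ?_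
  rw [div_le_iff₀ hm']
  linarith

/-- The determinant is at most a constant times X_{k+1+m}^(1 - ν) X_{k+1}^(-ν m), which yields ν m ≤
(1 - ν) s. -/
theorem le_exponent_of_simultaneous_det (hS : IsApproxSystem size err)
    (hP : IsMinimalSeq size err P) (hm : 0 < m) {C : ℝ} (hC : 0 ≤ C)
    (hdet : ∃ᶠ k in atTop,
      1 ≤ C * (size (P (k + 1 + m)) * err (P (k + m)) * err (P k) ^ m)) :
    uniformExponent size err 1 * ((((m + 1 : ℕ) : ℝ≥0∞) - 1) * uniformExponent size err 1 /
      (1 - uniformExponent size err 1)) ^ (1 / (((m + 1 : ℕ) : ℝ) - 1)) ≤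
        exponent size err 1 := by
  rcases eq_or_ne (uniformExponent size err 1) 0 with h0 | h0
  · simp [h0]
  rcases eq_or_ne (exponent size err 1) ∞ with hfin | hfin
  · simp [hfin]
  obtain ⟨a, b, ha, hb, hae, hbe, hab⟩ := exists_real_exponents (pos_iff_ne_zero.2 h0) hfin
  have hm' : (0 : ℝ) < m := by exact_mod_cast hm
  have key : ∀ᶠ ε : ℝ in nhdsWithin 0 (Set.Ioi 0),
      (a - ε) * m ≤ (1 - (a - ε)) * ((b + ε) / (a - ε)) ^ m := by
    filter_upwards [hab] with ε ⟨_, h1, h2, h3, h4⟩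
    set ν := a - ε
    set s := ((b + ε) / ν) ^ m
    have hs : 0 < s := by positivity
    have hg := hS.eventually_size_add_le (P := P) (by positivity)
      (hP.eventually_size_succ_le hS h1 h3 h4) m
    have herr := hP.eventually_err_le hS h3
    have hfr : ∃ᶠ k in atTop, (1 ≤ C * (size (P (k + 1 + m)) ^ (1 - ν) *
        size (P (k + 1)) ^ (-ν * m)) ∧ size (P (k + 1 + m)) ≤ size (P (k + 1)) ^ s) ∧
        1 ≤ size (P (k + 1)) := by
      refine (hdet.and_eventually ((herr.and ((tendsto_add_atTop_nat m).eventually herr)).and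
        (((tendsto_add_atTop_nat 1).eventually hg).and
        ((hP.tendsto_size_add hS 1).eventually_ge_atTop 1)))).mono ?_
      rintro k ⟨hk, ⟨h5, h8⟩, h6, h7⟩
      refine ⟨⟨hk.trans (mul_le_mul_of_nonneg_left ?_ hC), h6⟩, h7⟩
      have h9 : 0 < size (P (k + 1 + m)) :=
        one_pos.trans_le (h7.trans (hP.size_monotone (by omega)))
      rw [sub_eq_add_neg, Real.rpow_add h9, Real.rpow_one, Real.rpow_mul (by linarith),
        Real.rpow_natCast]
      rw [show k + m + 1 = k + 1 + m by ring] at h8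
      have := (hS.err_pos _ (hP.ne_zero k)).le
      gcongr
    -- For ν ≥ 1 the first power is at most 1 and the second tends to 0. Only with 1 - ν ≥ 0 may
    -- X_{k+1+m} be replaced by its upper bound X_{k+1}^s.
    have hν : ν < 1 := by
      by_contra! hν
      have := nonneg_of_frequently_one_le_mul_rpow (C := C) (e := -ν * m)
        (hP.tendsto_size_add hS 1) (hfr.mono fun k hk => hk.1.1.trans
        (mul_le_mul_of_nonneg_left (mul_le_of_le_one_left
          (Real.rpow_nonneg (hS.size_nonneg _) _)
          (Real.rpow_le_one_of_one_le_of_nonpos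
            (hk.2.trans (hP.size_monotone (by omega))) (by linarith))) hC))
      nlinarith
    have := nonneg_of_frequently_one_le_mul_rpow (C := C) (e := s * (1 - ν) + -ν * m)
        (hP.tendsto_size_add hS 1) (hfr.mono fun k hk => by
          refine hk.1.1.trans (mul_le_mul_of_nonneg_left ?_ hC)
          have h0 : 0 < size (P (k + 1)) := by linarith [hk.2]
          rw [Real.rpow_add h0, Real.rpow_mul h0.le s]
          have := hS.size_nonneg (P (k + 1 + m))
          exact mul_le_mul_of_nonneg_right (Real.rpow_le_rpow this hk.1.2 (by linarith))
            (Real.rpow_nonneg h0.le _))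
    nlinarith
  have hlim : a * m ≤ (1 - a) * (b / a) ^ m := by
    have h1 : Tendsto (fun ε : ℝ => (a - ε) * m) (nhdsWithin 0 (Set.Ioi 0))
        (nhds ((a - 0) * m)) :=
      (Continuous.tendsto (by fun_prop) _).mono_left nhdsWithin_le_nhds
    have h2 : ContinuousAt (fun ε : ℝ => (1 - (a - ε)) * ((b + ε) / (a - ε)) ^ m) 0 :=
      ContinuousAt.mul (by fun_prop) (ContinuousAt.pow (ContinuousAt.div (by fun_prop)
        (by fun_prop) (by simpa using ha.ne')) _)
    simpa using le_of_tendsto_of_tendsto h1 (h2.tendsto.mono_left nhdsWithin_le_nhds) key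
  -- The limit alone gives only a ≤ 1; strictness, which keeps the quotient finite, comes from a m >
  -- 0.
  have ha1 : 0 < 1 - a :=
    pos_of_mul_pos_left ((mul_pos ha hm').trans_le hlim) (by positivity)
  rw [hae, hbe]
  refine ofReal_mul_rpow_le ha hb hm ?_
  rw [natCast_succ_sub_one, ← ENNReal.ofReal_one, ← ENNReal.ofReal_sub _ ha.le,
    ← ENNReal.ofReal_mul hm'.le, ← ENNReal.ofReal_div_of_pos ha1]
  refine ENNReal.ofReal_le_ofReal ?_
  rw [div_le_iff₀ ha1]
  linarith

end Ratio

/-! ### The two concrete approximation systems -/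

section Systems

variable {n : ℕ} {ζ : Fin n → ℝ}

/-- The linear form `x + ζ₁ y₁ + ⋯ + ζₙ yₙ`. -/
noncomputable def linForm (ζ : Fin n → ℝ) (v : Fin (n + 1) → ℤ) : ℝ :=
  (v 0 : ℝ) + ∑ j : Fin n, ζ j * (v j.succ : ℝ)

theorem linForm_add (u v : Fin (n + 1) → ℤ) :
    linForm ζ (u + v) = linForm ζ u + linForm ζ v := by
  simp only [linForm, Pi.add_apply, Int.cast_add, mul_add, Finset.sum_add_distrib]
  ring

theorem linForm_smul (a : ℤ) (v : Fin (n + 1) → ℤ) : linForm ζ (a • v) = a * linForm ζ v := by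
  simp only [linForm, Pi.smul_apply, smul_eq_mul, Int.cast_mul, mul_add, Finset.mul_sum]
  congr 1
  exact Finset.sum_congr rfl fun j _ => by ring

theorem eq_zero_of_linForm_eq_zero (hζ : LinearIndependent ℚ (Fin.cons 1 ζ : Fin (n + 1) → ℝ))
    {v : Fin (n + 1) → ℤ} (h : linForm ζ v = 0) : v = 0 := by
  have := Fintype.linearIndependent_iff.1 hζ (fun i => (v i : ℚ)) (by
    rw [Fin.sum_univ_succ, ← h, linForm]
    simp [Rat.smul_def, mul_comm])
  exact funext fun i => by simpa using this i

theorem finite_norm_le (A : ℝ) : {v : Fin (n + 1) → ℤ | ‖v‖ ≤ A}.Finite := by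
  have : {v : Fin (n + 1) → ℤ | ‖v‖ ≤ A} = Metric.closedBall 0 A := by ext; simp
  rw [this]
  exact (isCompact_closedBall _ _).finite_of_discrete

theorem isApproxSystem_lin (hζ : LinearIndependent ℚ (Fin.cons 1 ζ : Fin (n + 1) → ℝ)) :
    IsApproxSystem (linSize (n := n)) (linError ζ) where
  size_nonneg _ := norm_nonneg _
  err_pos _ hv := abs_pos.2 fun h => hv (eq_zero_of_linForm_eq_zero hζ h)
  size_smul a v := by rw [linSize, linSize, norm_smul, Int.norm_eq_abs]
  err_smul a v := (congrArg abs (linForm_smul a v)).trans (abs_mul _ _)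
  finite A _ := (finite_norm_le A).subset fun _ hv => hv.1

theorem abs_le_linSize (v : Fin (n + 1) → ℤ) (i : Fin (n + 1)) : |(v i : ℝ)| ≤ linSize v := by
  rw [← Int.norm_eq_abs]
  exact norm_le_pi_norm v i

theorem abs_le_simError (v : Fin (n + 1) → ℤ) (j : Fin n) :
    |ζ j * (v 0 : ℝ) - (v j.succ : ℝ)| ≤ simError ζ v :=
  norm_le_pi_norm (fun j : Fin n => ζ j * (v 0 : ℝ) - (v j.succ : ℝ)) j

theorem isApproxSystem_sim (hn : 0 < n)
    (hζ : LinearIndependent ℚ (Fin.cons 1 ζ : Fin (n + 1) → ℝ)) :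
    IsApproxSystem (simSize (n := n)) (simError ζ) where
  size_nonneg _ := abs_nonneg _
  err_pos v hv := by
    refine lt_of_le_of_ne (norm_nonneg _) fun h => hv ?_
    have h0 : ∀ j, ζ j * (v 0 : ℝ) - (v j.succ : ℝ) = 0 := fun j =>
      abs_nonpos_iff.1 ((abs_le_simError v j).trans h.symm.le)
    have hv0 : v 0 = 0 := by
      -- The linear form vanishes at (-y₁, x, 0, …, 0) because ζ₁ x = y₁.
      have := congrFun (eq_zero_of_linForm_eq_zero hζ (v := Fin.cons (-v (Fin.succ ⟨0, hn⟩))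
        (Pi.single ⟨0, hn⟩ (v 0))) (by
          simp only [linForm, Fin.cons_zero, Fin.cons_succ, Int.cast_neg]
          rw [Finset.sum_eq_single ⟨0, hn⟩ (fun j _ hj => by simp [Pi.single_eq_of_ne hj])
            (by simp)]
          rw [Pi.single_eq_same]
          linarith [h0 ⟨0, hn⟩])) (Fin.succ ⟨0, hn⟩)
      simpa only [Fin.cons_succ, Pi.single_eq_same, Pi.zero_apply] using this
    funext i
    refine Fin.cases hv0 (fun j => ?_) i
    have := h0 j
    rw [hv0] at this
    simpa using this
  size_smul a v := by simp [simSize, abs_mul]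
  err_smul a v := by
    rw [simError, simError, ← Real.norm_eq_abs, ← norm_smul]
    congr 1
    funext j
    simp only [Pi.smul_apply, smul_eq_mul, Int.cast_mul]
    ring
  finite A B := by
    refine (finite_norm_le (A + (‖ζ‖ * A + B))).subset ?_
    rintro v ⟨hA, hB⟩
    have hA0 : 0 ≤ A := (abs_nonneg _).trans hA
    have hB0 : 0 ≤ B := (norm_nonneg _).trans hB
    have hζA : 0 ≤ ‖ζ‖ * A := by positivity
    refine (pi_norm_le_iff_of_nonneg (by positivity)).2 fun i => ?_
    rw [Int.norm_eq_abs]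
    refine Fin.cases (hA.trans (by linarith)) (fun j => ?_) i
    have h1 := (abs_le_simError (ζ := ζ) v j).trans hB
    have h2 : |ζ j * (v 0 : ℝ)| ≤ ‖ζ‖ * A := by
      rw [abs_mul]
      exact mul_le_mul (norm_le_pi_norm ζ j) hA (abs_nonneg _) (norm_nonneg _)
    have h3 := abs_sub_abs_le_abs_sub (v j.succ : ℝ) (ζ j * (v 0 : ℝ))
    rw [abs_sub_comm] at h3
    linarith

end Systems

/-! ### Determinants of n + 1 successive points -/

section DeterminantBounds

variable {m : ℕ} {ζ : Fin (m + 1) → ℝ}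

/-- Each Leibniz term takes one entry from column 0, and at least one of the two small rows remains
for another column. The row weights α, α, β, …, β and the weight δ/α of column 0 encode this. -/
theorem abs_det_le_of_two_small_rows (B : Matrix (Fin (m + 1 + 1)) (Fin (m + 1 + 1)) ℝ)
    {α β δ : ℝ} (hα : 0 < α) (hαβ : α ≤ β) (hδ : ∀ i, |B i 0| ≤ δ)
    (h0 : ∀ j : Fin (m + 1), |B 0 j.succ| ≤ α) (h1 : ∀ j : Fin (m + 1), |B 1 j.succ| ≤ α)
    (hB : ∀ i (j : Fin (m + 1)), |B i j.succ| ≤ β) :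
    |B.det| ≤ (m + 1 + 1).factorial * (δ * α * β ^ m) := by
  have hδ0 : 0 ≤ δ := (abs_nonneg _).trans (hδ 0)
  have := abs_det_le_of_abs_le_mul B (Fin.cons α (Fin.cons α fun _ => β))
    (Fin.cons (δ / α) fun _ => 1) (fun i j => by
      refine Fin.cases ?_ (fun j => ?_) j
      · refine (hδ i).trans ?_
        have hle : α ≤ (Fin.cons α (Fin.cons α fun _ => β) : Fin (m + 1 + 1) → ℝ) i := by
          refine Fin.cases (by simp) (fun i => Fin.cases (by simp) (fun i => ?_) i) i
          simpa using hαβ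
        calc δ = α * (δ / α) := by field_simp
          _ ≤ _ := by rw [Fin.cons_zero]; gcongr
      · rw [Fin.cons_succ, mul_one]
        refine Fin.cases (by simpa using h0 j) (fun i => Fin.cases ?_ (fun i => ?_) i) i
        · simpa using h1 j
        · simpa using hB _ j)
  refine this.trans (le_of_eq ?_)
  simp only [Fin.prod_univ_succ, Fin.cons_zero, Fin.cons_succ, Finset.prod_const, Finset.card_univ,
    Fintype.card_fin, one_pow]
  field_simp

theorem one_le_linear_det {v : Fin (m + 1 + 1) → Fin (m + 1 + 1) → ℤ}
    (hv : LinearIndependent ℤ v) {α β δ : ℝ} (hα : 0 < α) (hαβ : α ≤ β)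
    (hδ : ∀ i, linError ζ (v i) ≤ δ) (h0 : linSize (v 0) ≤ α) (h1 : linSize (v 1) ≤ α)
    (hβ : ∀ i, linSize (v i) ≤ β) :
    1 ≤ (m + 1 + 1).factorial * (δ * α * β ^ m) := by
  refine (one_le_abs_det_of_linearIndependent hv).trans ?_
  set A : Matrix (Fin (m + 1 + 1)) (Fin (m + 1 + 1)) ℝ := Matrix.of fun i j => (v i j : ℝ)
  -- By Cramer's rule the replacement multiplies the determinant by the coordinate 1 of (1, ζ);
  -- column 0 now holds the values of the linear form.
  have hdet : (A.updateCol 0 (A.mulVec (Fin.cons 1 ζ))).det = A.det := by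
    rw [← Matrix.cramer_apply, Matrix.cramer_eq_adjugate_mulVec, Matrix.mulVec_mulVec,
      Matrix.adjugate_mul, Matrix.smul_mulVec, Matrix.one_mulVec]
    simp
  rw [← hdet]
  refine abs_det_le_of_two_small_rows _ hα hαβ (fun i => ?_) (fun j => ?_) (fun j => ?_)
    fun i j => ?_
  · rw [Matrix.updateCol_self]
    refine le_of_eq_of_le ?_ (hδ i)
    rw [linError, Matrix.mulVec, dotProduct, Fin.sum_univ_succ]
    simp [A, mul_comm]
  all_goals rw [Matrix.updateCol_ne (Fin.succ_ne_zero j)]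
  · exact (abs_le_linSize (v 0) _).trans h0
  · exact (abs_le_linSize (v 1) _).trans h1
  · exact (abs_le_linSize (v i) _).trans (hβ i)

theorem one_le_simultaneous_det {v : Fin (m + 1 + 1) → Fin (m + 1 + 1) → ℤ}
    (hv : LinearIndependent ℤ v) {α β δ : ℝ} (hα : 0 < α) (hαβ : α ≤ β)
    (hδ : ∀ i, simSize (v i) ≤ δ) (h0 : simError ζ (v 0) ≤ α) (h1 : simError ζ (v 1) ≤ α)
    (hβ : ∀ i, simError ζ (v i) ≤ β) :
    1 ≤ (m + 1 + 1).factorial * (δ * α * β ^ m) := by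
  refine (one_le_abs_det_of_linearIndependent hv).trans ?_
  set A : Matrix (Fin (m + 1 + 1)) (Fin (m + 1 + 1)) ℝ := Matrix.of fun i j => (v i j : ℝ)
  set B : Matrix (Fin (m + 1 + 1)) (Fin (m + 1 + 1)) ℝ :=
    Matrix.of fun i j => A i j - (Fin.cons 0 ζ : Fin (m + 1 + 1) → ℝ) j * A i 0
  -- Subtracting ζ_j times column 0 from column j; transposing turns this into row operations.
  have hdet : A.det = B.det := by
    rw [← Matrix.det_transpose A, ← Matrix.det_transpose B]
    refine Matrix.det_eq_of_forall_row_eq_smul_add_const (Fin.cons 0 ζ) 0 (by simp) fun i j => ?_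
    simp [B]
  have hB : ∀ i (j : Fin (m + 1)), |B i j.succ| ≤ simError ζ (v i) := fun i j => by
    refine le_of_eq_of_le ?_ (abs_le_simError (v i) j)
    rw [abs_sub_comm]
    simp [B, A]
  rw [hdet]
  refine abs_det_le_of_two_small_rows _ hα hαβ (fun i => ?_) (fun j => (hB _ _).trans h0)
    (fun j => (hB _ _).trans h1) fun i j => (hB _ _).trans (hβ i)
  simpa [B, A, simSize] using hδ i

theorem IsMinimalSeq.wHat_bound {P : ℕ → (Fin (m + 1 + 1) → ℤ)}
    (hS : IsApproxSystem (linSize (n := m + 1)) (linError ζ))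
    (hP : IsMinimalSeq (linSize (n := m + 1)) (linError ζ) P) (hm : 0 < m)
    (hI : ∃ᶠ k in atTop, LinearIndependent ℤ fun i : Fin (m + 1 + 1) => P (k + i)) :
    wHat ζ 1 * ((wHat ζ 1 - 1) / (((m + 1 : ℕ) : ℝ≥0∞) - 1)) ^ (1 / (((m + 1 : ℕ) : ℝ) - 1)) ≤
      w ζ 1 := by
  refine le_exponent_of_linear_det hS hP hm (C := (m + 1 + 1).factorial) (by positivity)
    ((hI.and_eventually ((hP.tendsto_size_add hS 1).eventually_gt_atTop 0)).mono ?_)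
  rintro k ⟨hk, h1⟩
  refine one_le_linear_det hk h1 (hP.size_monotone (by omega))
    (fun i => hP.err_strictAnti.antitone (by omega)) (hP.size_monotone (by simp))
    (hP.size_monotone (by simp)) (fun i => hP.size_monotone (by omega))

theorem IsMinimalSeq.lamHat_bound {P : ℕ → (Fin (m + 1 + 1) → ℤ)}
    (hS : IsApproxSystem (simSize (n := m + 1)) (simError ζ))
    (hP : IsMinimalSeq (simSize (n := m + 1)) (simError ζ) P) (hm : 0 < m)
    (hI : ∃ᶠ k in atTop, LinearIndependent ℤ fun i : Fin (m + 1 + 1) => P (k + i)) :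
    lamHat ζ 1 * ((((m + 1 : ℕ) : ℝ≥0∞) - 1) * lamHat ζ 1 / (1 - lamHat ζ 1)) ^
      (1 / (((m + 1 : ℕ) : ℝ) - 1)) ≤ lam ζ 1 := by
  refine le_exponent_of_simultaneous_det hS hP hm (C := (m + 1 + 1).factorial) (by positivity)
    (hI.mono fun k hk => ?_)
  -- Errors decrease along the sequence, so reversing the order puts the two rows of smallest error
  -- first.
  refine one_le_simultaneous_det (v := fun i => P (k + (Fin.rev i : Fin (m + 1 + 1))))
    (hk.comp Fin.rev Fin.rev_injective) (hS.err_pos _ (hP.ne_zero _))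
    (hP.err_strictAnti.antitone (by omega)) (fun i => hP.size_monotone (by omega))
    (hP.err_strictAnti.antitone ?_) (hP.err_strictAnti.antitone ?_)
    (fun i => hP.err_strictAnti.antitone (by omega))
  · simp
  · simp [Fin.val_rev]

end DeterminantBounds

/-! ### Three independent successive points infinitely often -/

section Triples

variable {n : ℕ} {ζ : Fin n → ℝ}

/-- If the uniform exponent is 0 there is nothing to prove; if it is positive, arbitrarily small
errors occur and a minimal sequence exists. -/
theorem IsApproxSystem.sq_div_le_exponent {size err : (Fin (n + 1) → ℤ) → ℝ}
    (hS : IsApproxSystem size err)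
    (h : ∀ P, IsMinimalSeq size err P →
      ∃ᶠ k in atTop, LinearIndependent ℤ fun i : Fin 3 => P (k + i)) :
    uniformExponent size err 1 ^ 2 / exponent size err 1 ≤ exponent size err 3 := by
  rcases eq_or_ne (uniformExponent size err 1) 0 with h0 | h0
  · simp [h0]
  obtain ⟨ν, -, hν0, hν⟩ := ENNReal.lt_iff_exists_real_btwn.1 (pos_iff_ne_zero.2 h0)
  obtain ⟨P, hP⟩ := hS.exists_isMinimalSeq fun ε hε => by
    obtain ⟨X, ⟨u, hu, -, he⟩, hX⟩ := ((eventually_of_lt_uniformExponent hν).and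
      ((tendsto_rpow_neg_atTop (ENNReal.ofReal_pos.1 hν0)).eventually_lt_const hε)).exists
    exact ⟨u, hu, he.trans_lt hX⟩
  simpa using hP.pow_div_pow_le_exponent hS (m := 1) (h P hP)

theorem IsMinimalSeq.frequently_independent_sim (hn : 2 ≤ n)
    (hζ : LinearIndependent ℚ (Fin.cons 1 ζ : Fin (n + 1) → ℝ)) {P : ℕ → (Fin (n + 1) → ℤ)}
    (hP : IsMinimalSeq simSize (simError ζ) P) :
    ∃ᶠ k in atTop, LinearIndependent ℤ fun i : Fin 3 => P (k + i) := by
  have hS := isApproxSystem_sim (by omega) hζ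
  by_contra hcon
  obtain ⟨k₀, hk₀⟩ := eventually_atTop.1 ((not_frequently.1 hcon).and
    ((hP.tendsto_size hS).eventually_gt_atTop 0))
  -- Siegel's lemma for two equations in n + 1 ≥ 3 unknowns; its size bound is discarded.
  obtain ⟨t, ht0, ht, -⟩ := Int.Matrix.exists_ne_zero_int_vec_norm_le
    (Matrix.of ![P k₀, P (k₀ + 1)]) (by simp; omega) (by simp)
  have hmem : ∀ k, dotProduct (P (k₀ + k)) t = 0 ∧ dotProduct (P (k₀ + k + 1)) t = 0 := by
    intro k
    induction k with
    | zero => exact ⟨congrFun ht 0, congrFun ht 1⟩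
    | succ k ih =>
      refine ⟨ih.2, ?_⟩
      obtain ⟨hdep, hpos⟩ := hk₀ (k₀ + k) (by omega)
      obtain ⟨a, b, c, -, hc, hrel⟩ := hP.exists_relation hS hpos hdep
      have := congrArg (fun z => dotProduct z t) hrel
      simp only [add_dotProduct, smul_dotProduct, zero_dotProduct, ih.1, ih.2, smul_eq_mul,
        mul_zero, zero_add, mul_eq_zero] at this
      exact this.resolve_left hc
  -- Orthogonality to t turns x times the linear form at t into ∑ t_j (ζ_j x - y_j), which stays
  -- bounded while |x| tends to infinity.
  have hbound : ∀ k, simSize (P (k₀ + k)) * linError ζ t ≤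
      (∑ j : Fin n, |(t j.succ : ℝ)|) * simError ζ (P 0) := by
    intro k
    set v := P (k₀ + k)
    have hv : (∑ i, (v i : ℝ) * (t i : ℝ)) = 0 := by
      have := (hmem k).1
      rw [dotProduct] at this
      exact_mod_cast this
    rw [Fin.sum_univ_succ] at hv
    have hid : (v 0 : ℝ) * linForm ζ t =
        ∑ j : Fin n, (t j.succ : ℝ) * (ζ j * (v 0 : ℝ) - (v j.succ : ℝ)) := by
      have : ∑ j : Fin n, (t j.succ : ℝ) * (ζ j * (v 0 : ℝ) - (v j.succ : ℝ)) =
          (v 0 : ℝ) * ∑ j : Fin n, ζ j * (t j.succ : ℝ) -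
            ∑ j : Fin n, (v j.succ : ℝ) * (t j.succ : ℝ) := by
        rw [Finset.mul_sum, ← Finset.sum_sub_distrib]
        exact Finset.sum_congr rfl fun j _ => by ring
      rw [this, linForm]
      linarith
    calc simSize v * linError ζ t = |(v 0 : ℝ) * linForm ζ t| := (abs_mul _ _).symm
      _ ≤ ∑ j : Fin n, |(t j.succ : ℝ) * (ζ j * (v 0 : ℝ) - (v j.succ : ℝ))| := by
          rw [hid]; exact Finset.abs_sum_le_sum_abs _ _
      _ ≤ ∑ j : Fin n, |(t j.succ : ℝ)| * simError ζ (P 0) := by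
          refine Finset.sum_le_sum fun j _ => ?_
          rw [abs_mul]
          exact mul_le_mul_of_nonneg_left ((abs_le_simError v j).trans
            (hP.err_strictAnti.antitone (Nat.zero_le _))) (abs_nonneg _)
      _ = _ := (Finset.sum_mul _ _ _).symm
  have hpos : 0 < linError ζ t := (isApproxSystem_lin hζ).err_pos t ht0
  obtain ⟨k, hk, hk'⟩ := (((hP.tendsto_size hS).eventually_gt_atTop
    ((∑ j : Fin n, |(t j.succ : ℝ)|) * simError ζ (P 0) / linError ζ t)).and
    (eventually_ge_atTop k₀)).exists
  obtain ⟨l, rfl⟩ := Nat.exists_eq_add_of_le hk'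
  rw [div_lt_iff₀ hpos] at hk
  exact absurd (hbound l) (not_le.2 hk)

/-- A weak form of Dirichlet's theorem for linear forms in at least two numbers, obtained from the
pigeonhole principle applied to the first two of them. -/
theorem exists_linError_le (hn : 2 ≤ n) (ζ : Fin n → ℝ) :
    ∃ K : ℝ, 0 < K ∧ ∀ N : ℕ, 0 < N → ∃ u : Fin (n + 1) → ℤ, u ≠ 0 ∧
      linSize u ≤ K * N ∧ linError ζ u ≤ 1 / (N : ℝ) ^ 2 := by
  obtain ⟨m, rfl⟩ := Nat.exists_eq_add_of_le' hn
  refine ⟨1 + |ζ 0| + |ζ 1|, by positivity, fun N hN => ?_⟩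
  have hN' : (1 : ℝ) ≤ N := by exact_mod_cast hN
  let g : ℕ × ℕ → ℝ := fun p => ζ 0 * p.1 + ζ 1 * p.2
  let f : ℕ × ℕ → ℤ := fun p => ⌊Int.fract (g p) * (N : ℝ) ^ 2⌋
  -- (N + 1)² pairs fall into N² intervals of length 1/N².
  obtain ⟨p, hp, q, hq, hpq, hf⟩ := Finset.exists_ne_map_eq_of_card_lt_of_maps_to
    (s := Finset.range (N + 1) ×ˢ Finset.range (N + 1)) (t := Finset.Ico (0 : ℤ) ((N ^ 2 : ℕ) : ℤ))
    (f := f) (by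
      simp only [Int.card_Ico, Finset.card_product, Finset.card_range, sub_zero, Int.toNat_natCast]
      nlinarith) (fun p _ => by
      refine Finset.mem_coe.2 (Finset.mem_Ico.2
        ⟨Int.floor_nonneg.2 (mul_nonneg (Int.fract_nonneg _) (by positivity)), ?_⟩)
      refine Int.floor_lt.2 ?_
      push_cast
      exact mul_lt_of_lt_one_left (by positivity) (Int.fract_lt_one _))
  simp only [Finset.mem_product, Finset.mem_range] at hp hq
  have hfr : |Int.fract (g p) - Int.fract (g q)| ≤ 1 / (N : ℝ) ^ 2 := by
    have := (Int.abs_sub_lt_one_of_floor_eq_floor hf).le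
    rw [← sub_mul, abs_mul, abs_of_pos (by positivity : (0 : ℝ) < (N : ℝ) ^ 2)] at this
    rwa [le_div_iff₀ (by positivity)]
  set y₁ : ℤ := (p.1 : ℤ) - q.1
  set y₂ : ℤ := (p.2 : ℤ) - q.2
  set x : ℤ := ⌊g q⌋ - ⌊g p⌋
  have hy₁ : |(y₁ : ℝ)| ≤ N := by
    rw [← Int.cast_abs]
    exact_mod_cast (abs_le.2 ⟨by omega, by omega⟩ : |y₁| ≤ (N : ℤ))
  have hy₂ : |(y₂ : ℝ)| ≤ N := by
    rw [← Int.cast_abs]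
    exact_mod_cast (abs_le.2 ⟨by omega, by omega⟩ : |y₂| ≤ (N : ℤ))
  have hsum : (x : ℝ) + (ζ 0 * y₁ + ζ 1 * y₂) = Int.fract (g p) - Int.fract (g q) := by
    simp only [x, y₁, y₂, g, Int.fract]
    push_cast
    ring
  have hx : |(x : ℝ)| ≤ 1 + |ζ 0| * N + |ζ 1| * N := by
    have h1 : (x : ℝ) = (Int.fract (g p) - Int.fract (g q)) - ζ 0 * y₁ - ζ 1 * y₂ := by linarith
    have h2 : |Int.fract (g p) - Int.fract (g q)| ≤ 1 := by
      refine hfr.trans ?_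
      rw [div_le_one (by positivity)]
      exact one_le_pow₀ hN'
    have h3 : |ζ 0 * y₁| ≤ |ζ 0| * N := by rw [abs_mul]; gcongr
    have h4 : |ζ 1 * y₂| ≤ |ζ 1| * N := by rw [abs_mul]; gcongr
    rw [h1]
    linarith [abs_sub (Int.fract (g p) - Int.fract (g q) - ζ 0 * y₁) (ζ 1 * y₂),
      abs_sub (Int.fract (g p) - Int.fract (g q)) (ζ 0 * y₁)]
  have hz₀ := mul_nonneg (abs_nonneg (ζ 0)) (by linarith : (0 : ℝ) ≤ N)
  have hz₁ := mul_nonneg (abs_nonneg (ζ 1)) (by linarith : (0 : ℝ) ≤ N)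
  refine ⟨Fin.cons x (Fin.cons y₁ (Fin.cons y₂ 0)), fun h0 => hpq ?_, ?_, ?_⟩
  · have h1 : y₁ = 0 := congrFun h0 (Fin.succ 0)
    have h2 : y₂ = 0 := congrFun h0 (Fin.succ (Fin.succ 0))
    exact Prod.ext (by omega) (by omega)
  · refine (pi_norm_le_iff_of_nonneg (by positivity)).2 fun i => ?_
    rw [Int.norm_eq_abs]
    refine Fin.cases ?_ (fun i => Fin.cases ?_ (fun i => Fin.cases ?_ (fun i => ?_) i) i) i
    · simp only [Fin.cons_zero]
      linarith
    · simp only [Fin.cons_zero, Fin.cons_succ]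
      linarith
    · simp only [Fin.cons_zero, Fin.cons_succ]
      linarith
    · simp only [Fin.cons_succ, Pi.zero_apply, Int.cast_zero, abs_zero]
      positivity
  · refine le_of_eq_of_le ?_ hfr
    rw [← hsum, linError]
    simp [Fin.sum_univ_succ]

theorem IsMinimalSeq.frequently_independent_lin (hn : 2 ≤ n)
    (hζ : LinearIndependent ℚ (Fin.cons 1 ζ : Fin (n + 1) → ℝ)) {P : ℕ → (Fin (n + 1) → ℤ)}
    (hP : IsMinimalSeq linSize (linError ζ) P) :
    ∃ᶠ k in atTop, LinearIndependent ℤ fun i : Fin 3 => P (k + i) := by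
  have hS := isApproxSystem_lin hζ
  by_contra hcon
  obtain ⟨k₀, hk₀⟩ := eventually_atTop.1 ((not_frequently.1 hcon).and
    ((hP.tendsto_size hS).eventually_gt_atTop 0))
  -- Plücker coordinates of a pair of points, extended by their linear form values: `M` is integral,
  -- `Z` contains the form. In a fixed plane, moving to the next pair multiplies all of them by the
  -- same factor a/c.
  let M : (Fin (n + 1) → ℤ) → (Fin (n + 1) → ℤ) → Fin (n + 1) → Fin (n + 1) → ℝ :=
    fun u v i j => (u i : ℝ) * v j - u j * v i
  let Z : (Fin (n + 1) → ℤ) → (Fin (n + 1) → ℤ) → Fin (n + 1) → ℝ :=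
    fun u v i => linForm ζ u * v i - linForm ζ v * u i
  have hprop : ∀ k, ∃ d : ℝ, d ≠ 0 ∧
      (∀ i j, M (P (k₀ + k)) (P (k₀ + k + 1)) i j = d * M (P k₀) (P (k₀ + 1)) i j) ∧
      ∀ i, Z (P (k₀ + k)) (P (k₀ + k + 1)) i = d * Z (P k₀) (P (k₀ + 1)) i := by
    intro k
    induction k with
    | zero => exact ⟨1, one_ne_zero, fun i j => (one_mul _).symm, fun i => (one_mul _).symm⟩
    | succ k ih =>
      obtain ⟨d, hd, hM, hZ⟩ := ih
      obtain ⟨hdep, hpos⟩ := hk₀ (k₀ + k) (by omega)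
      obtain ⟨a, b, c, ha, hc, hrel⟩ := hP.exists_relation hS hpos hdep
      have ha' : (a : ℝ) ≠ 0 := by exact_mod_cast ha
      have hc' : (c : ℝ) ≠ 0 := by exact_mod_cast hc
      have hcoord : ∀ i, (a : ℝ) * P (k₀ + k) i + b * P (k₀ + k + 1) i +
          c * P (k₀ + k + 2) i = 0 := fun i => by
        have := congrFun hrel i
        simp only [Pi.add_apply, Pi.smul_apply, smul_eq_mul, Pi.zero_apply] at this
        exact_mod_cast this
      have hform : (a : ℝ) * linForm ζ (P (k₀ + k)) + b * linForm ζ (P (k₀ + k + 1)) +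
          c * linForm ζ (P (k₀ + k + 2)) = 0 := by
        rw [← linForm_smul, ← linForm_smul, ← linForm_smul, ← linForm_add, ← linForm_add, hrel]
        simp [linForm]
      refine ⟨a / c * d, by positivity, fun i j => ?_, fun i => ?_⟩
      · rw [mul_assoc, ← hM i j, div_mul_eq_mul_div, eq_div_iff hc']
        simp only [M]
        linear_combination (P (k₀ + k + 1) i : ℝ) * hcoord j - (P (k₀ + k + 1) j : ℝ) * hcoord i
      · rw [mul_assoc, ← hZ i, div_mul_eq_mul_div, eq_div_iff hc']
        simp only [Z]
        linear_combination linForm ζ (P (k₀ + k + 1)) * hcoord i - (P (k₀ + k + 1) i : ℝ) * hform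
  have hpos₀ := (hk₀ k₀ le_rfl).2
  have hMne : ∃ i j, M (P k₀) (P (k₀ + 1)) i j ≠ 0 := by
    by_contra! h
    obtain ⟨i, hi⟩ := Function.ne_iff.1 (hP.ne_zero k₀)
    have := hP.pair_independent hS hpos₀ (a := P (k₀ + 1) i) (b := -P k₀ i) (by
      funext j
      have := h i j
      simp only [M] at this
      simp only [Pi.add_apply, Pi.smul_apply, smul_eq_mul, Pi.zero_apply]
      have h' : P k₀ i * P (k₀ + 1) j - P k₀ j * P (k₀ + 1) i = 0 := by exact_mod_cast this
      linarith)
    exact hi (neg_eq_zero.1 this.2)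
  obtain ⟨i, j, hij⟩ := hMne
  have hZne : ∃ l, Z (P k₀) (P (k₀ + 1)) l ≠ 0 := by
    by_contra! h
    have hL := abs_pos.1 (hS.err_pos _ (hP.ne_zero k₀))
    refine hij ?_
    have h1 := h i
    have h2 := h j
    simp only [Z] at h1 h2
    have : linForm ζ (P k₀) * M (P k₀) (P (k₀ + 1)) i j = 0 := by
      simp only [M]
      linear_combination (P k₀ i : ℝ) * h2 - (P k₀ j : ℝ) * h1
    exact (mul_eq_zero.1 this).resolve_left hL
  obtain ⟨l, hl⟩ := hZne
  -- The integer minor `M` is nonzero, which bounds |d| from below; `Z` is at most 2 L_k X_{k+1}, so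
  -- this product cannot tend to 0.
  have hlower : ∀ k, |Z (P k₀) (P (k₀ + 1)) l| ≤ |M (P k₀) (P (k₀ + 1)) i j| *
      (2 * (linError ζ (P (k₀ + k)) * linSize (P (k₀ + k + 1)))) := by
    intro k
    obtain ⟨d, hd, hM, hZ⟩ := hprop k
    have hone : 1 ≤ |d| * |M (P k₀) (P (k₀ + 1)) i j| := by
      rw [← abs_mul, ← hM]
      have hne : M (P (k₀ + k)) (P (k₀ + k + 1)) i j ≠ 0 := by
        rw [hM]; exact mul_ne_zero hd hij
      have hcast : M (P (k₀ + k)) (P (k₀ + k + 1)) i j = ((P (k₀ + k) i * P (k₀ + k + 1) j -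
          P (k₀ + k) j * P (k₀ + k + 1) i : ℤ) : ℝ) := by simp only [M]; push_cast; ring
      rw [hcast] at hne ⊢
      rw [← Int.cast_abs]
      exact_mod_cast Int.one_le_abs (by exact_mod_cast hne)
    have hZle : |d| * |Z (P k₀) (P (k₀ + 1)) l| ≤
        2 * (linError ζ (P (k₀ + k)) * linSize (P (k₀ + k + 1))) := by
      rw [← abs_mul, ← hZ]
      have e1 : |linForm ζ (P (k₀ + k + 1))| ≤ linError ζ (P (k₀ + k)) :=
        hP.err_strictAnti.antitone (Nat.le_succ _)
      have e2 : |(P (k₀ + k) l : ℝ)| ≤ linSize (P (k₀ + k + 1)) :=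
        (abs_le_linSize _ l).trans (hP.size_monotone (Nat.le_succ _))
      have e3 : |linForm ζ (P (k₀ + k)) * (P (k₀ + k + 1) l : ℝ)| ≤
          linError ζ (P (k₀ + k)) * linSize (P (k₀ + k + 1)) := by
        rw [abs_mul]
        exact mul_le_mul le_rfl (abs_le_linSize _ l) (abs_nonneg _) (abs_nonneg _)
      have e4 : |linForm ζ (P (k₀ + k + 1)) * (P (k₀ + k) l : ℝ)| ≤
          linError ζ (P (k₀ + k)) * linSize (P (k₀ + k + 1)) := by
        rw [abs_mul]
        exact mul_le_mul e1 e2 (abs_nonneg _) (abs_nonneg _)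
      exact (abs_sub _ _).trans (by linarith)
    have hM0 := abs_nonneg (M (P k₀) (P (k₀ + 1)) i j)
    have hZ0 := abs_nonneg (Z (P k₀) (P (k₀ + 1)) l)
    calc |Z (P k₀) (P (k₀ + 1)) l|
        ≤ (|d| * |M (P k₀) (P (k₀ + 1)) i j|) * |Z (P k₀) (P (k₀ + 1)) l| :=
          le_mul_of_one_le_left hZ0 hone
      _ = |M (P k₀) (P (k₀ + 1)) i j| * (|d| * |Z (P k₀) (P (k₀ + 1)) l|) := by ring
      _ ≤ _ := mul_le_mul_of_nonneg_left hZle hM0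
  obtain ⟨K, hK, hD⟩ := exists_linError_le hn ζ
  set D := |M (P k₀) (P (k₀ + 1)) i j|
  have hD0 : 0 ≤ D := abs_nonneg _
  obtain ⟨k, ⟨hk1, hk2⟩, hk'⟩ := ((((hP.tendsto_size_add hS 1).eventually_gt_atTop (2 * K)).and
    ((hP.tendsto_size_add hS 1).eventually_gt_atTop
    (D * 2 * (16 * K ^ 2) / |Z (P k₀) (P (k₀ + 1)) l|))).and (eventually_ge_atTop k₀)).exists
  obtain ⟨r, rfl⟩ := Nat.exists_eq_add_of_le hk'
  have hlow := hlower r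
  set X := linSize (P (k₀ + r + 1))
  have hX : 0 < X := by linarith
  rw [div_lt_iff₀ (abs_pos.2 hl)] at hk2
  have hN1 : 1 ≤ X / (2 * K) := by rw [one_le_div (by positivity)]; linarith
  have hN : 0 < ⌊X / (2 * K)⌋₊ := Nat.floor_pos.2 hN1
  have hNle : (⌊X / (2 * K)⌋₊ : ℝ) ≤ X / (2 * K) := Nat.floor_le (by positivity)
  have hNge : X / (4 * K) ≤ (⌊X / (2 * K)⌋₊ : ℝ) := by
    have h1 := Nat.lt_floor_add_one (X / (2 * K))
    have h2 : (1 : ℝ) ≤ ⌊X / (2 * K)⌋₊ := by exact_mod_cast hN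
    have h3 : X / (4 * K) = X / (2 * K) / 2 := by field_simp; norm_num
    rw [h3]
    linarith
  -- With N = ⌊X / (2K)⌋ the vector has size at most X/2 < X, so minimality applies; N ≥ X / (4K) is
  -- the source of 16 K².
  obtain ⟨u, hu, hus, hue⟩ := hD _ hN
  have hlt : linSize u < X := by
    refine hus.trans_lt ((mul_le_mul_of_nonneg_left hNle hK.le).trans_lt ?_)
    have : K * (X / (2 * K)) = X / 2 := by field_simp
    rw [this]
    linarith
  have herr : linError ζ (P (k₀ + r)) ≤ 16 * K ^ 2 / X ^ 2 := by
    refine (hP.minimal _ u hu hlt).trans (hue.trans ?_)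
    have h4 : 16 * K ^ 2 / X ^ 2 = 1 / (X / (4 * K)) ^ 2 := by field_simp; norm_num
    rw [h4]
    exact one_div_le_one_div_of_le (by positivity) (by gcongr)
  have hprod : linError ζ (P (k₀ + r)) * X ≤ 16 * K ^ 2 / X := by
    calc linError ζ (P (k₀ + r)) * X ≤ 16 * K ^ 2 / X ^ 2 * X := by gcongr
      _ = 16 * K ^ 2 / X := by field_simp
  have hfin : |Z (P k₀) (P (k₀ + 1)) l| ≤ D * 2 * (16 * K ^ 2) / X := by
    calc _ ≤ D * (2 * (linError ζ (P (k₀ + r)) * X)) := hlow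
      _ ≤ D * (2 * (16 * K ^ 2 / X)) := by gcongr
      _ = _ := by ring
  rw [le_div_iff₀ hX] at hfin
  linarith

end Triples

end DiophApprox

theorem theorem4p3 (n : ℕ) (hn : 2 ≤ n) (ζ : Fin n → ℝ)
    (hζ : LinearIndependent ℚ (Fin.cons 1 ζ : Fin (n + 1) → ℝ)) :
    -- the unconditional bounds
    DiophApprox.w ζ 3 ≥ DiophApprox.wHat ζ 1 ^ 2 / DiophApprox.w ζ 1 ∧
    DiophApprox.lam ζ 3 ≥ DiophApprox.lamHat ζ 1 ^ 2 / DiophApprox.lam ζ 1 ∧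
    -- the conditional bounds for the linear form
    (DiophApprox.IndepSuccessiveBestApprox
        (DiophApprox.linSize (n := n)) (DiophApprox.linError ζ) →
      (∀ i : ℕ, 1 ≤ i → i ≤ n + 1 →
        DiophApprox.w ζ i ≥
          DiophApprox.wHat ζ 1 ^ ((i : ℤ) - 1) / DiophApprox.w ζ 1 ^ ((i : ℤ) - 2)) ∧
      DiophApprox.w ζ 1 ≥
        DiophApprox.wHat ζ 1 *
          ((DiophApprox.wHat ζ 1 - 1) / ((n : ℝ≥0∞) - 1)) ^ (1 / ((n : ℝ) - 1))) ∧
    -- the conditional bounds for simultaneous approximation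
    (DiophApprox.IndepSuccessiveBestApprox
        (DiophApprox.simSize (n := n)) (DiophApprox.simError ζ) →
      (∀ i : ℕ, 1 ≤ i → i ≤ n + 1 →
        DiophApprox.lam ζ i ≥
          DiophApprox.lamHat ζ 1 ^ ((i : ℤ) - 1) / DiophApprox.lam ζ 1 ^ ((i : ℤ) - 2)) ∧
      DiophApprox.lam ζ 1 ≥
        DiophApprox.lamHat ζ 1 *
          (((n : ℝ≥0∞) - 1) * DiophApprox.lamHat ζ 1 / (1 - DiophApprox.lamHat ζ 1)) ^
            (1 / ((n : ℝ) - 1))) := by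
  have hL := DiophApprox.isApproxSystem_lin hζ
  have hS := DiophApprox.isApproxSystem_sim (by omega) hζ
  refine ⟨hL.sq_div_le_exponent fun P hP => hP.frequently_independent_lin hn hζ,
    hS.sq_div_le_exponent fun P hP => hP.frequently_independent_sim hn hζ, ?_, ?_⟩
  · rintro ⟨P, hP, hI⟩
    have hP := hP.isMinimalSeq hL
    have hI := Nat.frequently_atTop_iff_infinite.2 hI
    refine ⟨fun i hi hin => hP.zpow_div_zpow_le_exponent hL hi
      (DiophApprox.frequently_independent_of_le hin hI), ?_⟩
    obtain ⟨m, rfl⟩ := Nat.exists_eq_add_of_le' (show 1 ≤ n by omega)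
    exact hP.wHat_bound hL (by omega) hI
  · rintro ⟨P, hP, hI⟩
    have hP := hP.isMinimalSeq hS
    have hI := Nat.frequently_atTop_iff_infinite.2 hI
    refine ⟨fun i hi hin => hP.zpow_div_zpow_le_exponent hS hi
      (DiophApprox.frequently_independent_of_le hin hI), ?_⟩
    obtain ⟨m, rfl⟩ := Nat.exists_eq_add_of_le' (show 1 ≤ n by omega)
    exact hP.lamHat_bound hS (by omega) hI
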